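/- **Proposition 2.2 (the extended Chilean arrangement is free).** Let $S=\mathbb{C}[x_0,x_1,x_2]$. For a homogeneous polynomial $F\in S$ of degree $d$ put $D(F)=\{\theta\in \mathrm{Der}_{\mathbb C}(S) : \theta(F)\in\langle F\rangle\}$ and $D_0(F)=\{\theta\in \mathrm{Der}_{\mathbb C}(S) : \theta(F)=0\}$. Writing $\theta=\sum_j a_j\,\partial/\partial x_j$, the module $D_0(F)$ is the module of syzygies $(a_0,a_1,a_2)$ of the partial derivatives of $F$. The curve $F=0$ is *free* if $D(F)$ is a free $S$-module. It has *exponents* $(d_1,d_2)$ if $D_0(F)$ is a free $S$-module with a basis of two homogeneous syzygies of degrees $d_1$ and $d_2$ (the degree being that of the coefficients $a_j$), so that the Milnor algebra has the resolution $0\to S(-d_1-(d-1))\oplus S(-d_2-(d-1))\to S(-d+1)^3\to S$. Let $\omega$ be a primitive cube root of unity and let $t\in\mathbb{C}$ with $t\neq 0$, $t^3\neq 1$, $t^3\neq -8$. For $(a,b)\in\mathbb{F}_3^2$, with $a,b\in\{0,1,2\}$, let $p_{a,b}\in\mathbb{P}^2_{\mathbb C}$ be the point whose $i$-th coordinate ($i=0,1,2$)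 is $\omega^{bi}t$ if $i=a$ and $\omega^{bi}$ if $i\ne a$; these nine points are the orbit of $(t:1:1)$ under the group generated by the cyclic permutation of the coordinates and $\mathrm{diag}(1,\omega,\omega^2)$. A *Chilean family of conics* consists of one quadratic form $Q_\ell\in S$ for each of the $12$ lines $\ell$ of the affine plane $\mathbb{F}_3^2$, such that $Q_\ell(p_v)=0$ if and only if $v\notin\ell$. Thus each of the $12$ conics $Q_\ell=0$ contains exactly $6$ of the nine points, and each of the nine points lies on exactly $8$ of the conics. Then a Chilean family of conics exists for these $\omega$ and $t$, and for every such family $(Q_\ell)$ the extended Chilean arrangement $\mathcal{EC}$, consisting of the $12$ conics and the $9$ lines of the dual Hesse arrangement and given by $$F=(x_0^3-x_1^3)(x_1^3-x_2^3)(x_2^3-x_0^3)\prod_{\ell}Q_\ell$$ of degree $33$, is free with exponents $(16,16)$. -/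

import Mathlib

namespace ChileanArrangement

/-- The homogeneous coordinate ring `ℂ[x₀, x₁, x₂]` of the complex projective plane. -/
abbrev S : Type := MvPolynomial (Fin 3) ℂ

/-! ### Free plane curves and their exponents -/

/-- The module `D(C) = {θ ∈ Der(S) | θ(F) ∈ ⟨F⟩}` of polynomial derivations tangent to the
curve `F = 0`. -/
def tangentDer (F : S) : Submodule S (Derivation ℂ S S) where
  carrier := {θ | θ F ∈ Ideal.span {F}}
  zero_mem' := by simp
  add_mem' := fun {a b} ha hb => by
    simpa using Ideal.add_mem _ ha hb
  smul_mem' := fun c θ hθ => by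
    simpa using Ideal.mul_mem_left _ c hθ

/-- The module `D₀(C) = syz(J_F)` of syzygies of the Jacobian ideal of `F`: the derivation
`θ = a₀ ∂₀ + a₁ ∂₁ + a₂ ∂₂`, where `aⱼ = θ(xⱼ)`, is identified with the syzygy `(a₀, a₁, a₂)`
of the partial derivatives of `F`, because `θ(F) = ∑ⱼ aⱼ ∂ⱼF`. -/
def jacobianSyz (F : S) : Submodule S (Derivation ℂ S S) where
  carrier := {θ | θ F = 0}
  zero_mem' := by simp
  add_mem' := fun {a b} ha hb => by
    have ha' : a F = 0 := ha
    have hb' : b F = 0 := hb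
    simp [ha', hb']
  smul_mem' := fun c θ hθ => by
    have h' : θ F = 0 := hθ
    simp [h']

/-- The curve `F = 0` is free: the module of derivations tangent to it is a free `S`-module. -/
def IsFreeCurve (F : S) : Prop := Module.Free S (tangentDer F)

/-- The curve `F = 0` has exponents `(d₁, d₂)`: the syzygy module of the Jacobian ideal is free on
two homogeneous syzygies of degrees `d₁` and `d₂`. For `F` of degree `d` these syzygies are the
columns of the left map of the minimal graded free resolution
`0 → S(-d₁-(d-1)) ⊕ S(-d₂-(d-1)) → S(-d+1)³ → S` of `S / J_F`. -/
def HasExponents (F : S) (d₁ d₂ : ℕ) : Prop :=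
  ∃ b : Module.Basis (Fin 2) S (jacobianSyz F),
    (∀ j : Fin 3, ((b 0 : Derivation ℂ S S) (MvPolynomial.X j)).IsHomogeneous d₁) ∧
    (∀ j : Fin 3, ((b 1 : Derivation ℂ S S) (MvPolynomial.X j)).IsHomogeneous d₂)

/-! ### The arrangement -/

/-- The nine points: the orbit of `(t : 1 : 1)` under the group generated by the cyclic
permutation of the coordinates and `diag(1, ω, ω²)`. The point with label `(a, b)` has `i`-th
coordinate `ω ^ (b i) t` if `i = a`, and `ω ^ (b i)` otherwise. -/
def point (ω t : ℂ) (v : ZMod 3 × ZMod 3) : Fin 3 → ℂ :=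
  fun i => ω ^ (v.2.val * i.val) * (if i.val = v.1.val then t else 1)

/-- Normal vectors of the four directions of lines in the affine plane over `ZMod 3`. -/
def normal : Fin 4 → ZMod 3 × ZMod 3 := ![(1, 0), (0, 1), (1, 1), (1, 2)]

/-- The twelve lines of the affine plane over `ZMod 3`, indexed by a direction and an offset. -/
def affLine (l : Fin 4 × ZMod 3) : Set (ZMod 3 × ZMod 3) :=
  {v | (normal l.1).1 * v.1 + (normal l.1).2 * v.2 = l.2}

/-- `Q` is a family of equations of the twelve conics of the Chilean arrangement: the conic
labelled by a line `l` of the affine plane over `ZMod 3` contains, among the nine points, exactly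
the six whose labels are off `l`. So every point lies on eight of the conics. -/
def IsChilean (ω t : ℂ) (Q : Fin 4 × ZMod 3 → S) : Prop :=
  ∀ l, (Q l).IsHomogeneous 2 ∧
    ∀ v, MvPolynomial.eval (point ω t v) (Q l) = 0 ↔ v ∉ affLine l

/-- The product `(x³ - y³)(y³ - z³)(z³ - x³)` of the equations of the nine lines of the dual Hesse
arrangement. -/
noncomputable def dualHesse : S :=
  (MvPolynomial.X 0 ^ 3 - MvPolynomial.X 1 ^ 3) * (MvPolynomial.X 1 ^ 3 - MvPolynomial.X 2 ^ 3) *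
    (MvPolynomial.X 2 ^ 3 - MvPolynomial.X 0 ^ 3)

/-- The equation, of degree 33, of the extended arrangement: the twelve conics and the nine lines
of the dual Hesse arrangement. -/
noncomputable def extendedChilean (Q : Fin 4 × ZMod 3 → S) : S := (∏ l, Q l) * dualHesse

end ChileanArrangement

/-!
The six points off a line of the affine plane over `𝔽₃` impose independent conditions on conics, so
a Chilean family is unique up to nonzero constants: the conics of the lines `a = const` are
`t x₀² - x₁x₂` and its cyclic permutations, and all others are diagonal transforms of
`x₀² + x₁² + x₂² + (τ + 1)(x₁x₂ + x₀x₂ + x₀x₁)` with `τ³ = t³` (`IsChilean.exists_eq_C_mul`).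
The conditions `t ≠ 0`, `t³ ≠ 1`, `t³ ≠ -8` say that these conics are smooth, hence irreducible
(`quad_prime`).

The three conics of a parallel class form a sextic with double points at the nine points. Such
sextics form a pencil, spanned by a sextic `q` and the square of the cubic `c` of the Hesse pencil
through the nine points. So the product `P` of the twelve conics is a product of four members of the
pencil, namely a multiple of `q ((c² - (t³ - 4) q)³ - 27 t⁶ q³)` (`prod_stdConic`).

The nine lines of the dual Hesse arrangement are the mirrors of the reflection group `G(3,3,3)`. Its
invariants are the polynomials in `f = x₀³ + x₁³ + x₂³`, `x₀x₁x₂` and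
`h = x₀³x₁³ + x₁³x₂³ + x₂³x₀³`; both `c` and `q` are among them. The invariant derivations are
generated by the Euler derivation, `∑ xᵢ⁴ ∂ᵢ` and `x₁²x₂² ∂₀ + x₀²x₂² ∂₁ + x₀²x₁² ∂₂`, whose
determinant is the product of the nine lines (`det_syzygy`). All of them are tangent to the nine
lines, so it remains to find invariant `β`, `γ` for which the combination `combDer t β γ` maps `P`
to a multiple of itself. In terms of `c`, `q` and `g = x₀x₁x₂ / t` this is a linear problem with a
two-dimensional space of solutions in degree 12, and the determinant of two basic solutions is `-2 P`
(`betaOne_mul_gammaTwo_sub`). Corrected by multiples of the Euler derivation they become two Jacobian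
syzygies of degree 16. Together with the Euler derivation they satisfy Saito's criterion
(`isFreeCurve_and_hasExponents`), which applies because the 21 components are distinct primes.
-/

namespace ChileanArrangement
open MvPolynomial

/-! ### Saito's criterion for reduced plane curves -/

/-- The Euler derivation `∑ xⱼ ∂ⱼ`. -/
noncomputable def euler : Derivation ℂ S S := mkDerivation ℂ X

/-- The matrix whose `i`-th row lists the coefficients of the derivation `D i`. -/
noncomputable def coeffMatrix (D : Fin 3 → Derivation ℂ S S) : Matrix (Fin 3) (Fin 3) S :=
  Matrix.of fun i j => D i (X j)

lemma derivation_apply_eq_sum (D : Derivation ℂ S S) (p : S) :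
    D p = ∑ j, D (X j) * pderiv j p := by
  have h : D = ∑ j, D (X j) • (pderiv j : Derivation ℂ S S) := by
    refine derivation_ext fun i => ?_
    fin_cases i <;> simp [Fin.sum_univ_three, pderiv_X]
  conv_lhs => rw [h]
  simp [Fin.sum_univ_three]

lemma euler_apply {p : S} {n : ℕ} (hp : p.IsHomogeneous n) : euler p = n • p := by
  rw [derivation_apply_eq_sum, ← hp.sum_X_mul_pderiv]
  simp [euler, mkDerivation_X]

/-- The partial derivatives have smaller degree, and by Euler's identity they do not all vanish. -/
lemma exists_not_dvd_pderiv {p : S} {d : ℕ} (hp : p.IsHomogeneous d) (hp0 : p ≠ 0) (hd : d ≠ 0) :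
    ∃ j, ¬ p ∣ pderiv j p := by
  by_contra! h
  have h0 : ∀ j, pderiv j p = 0 := by
    intro j
    by_contra hj
    have h1 := totalDegree_le_of_dvd_of_isDomain (h j) hj
    have h2 := (hp.pderiv (i := j)).totalDegree_le
    rw [hp.totalDegree hp0] at h1
    omega
  have h1 := hp.sum_X_mul_pderiv
  simp only [h0, mul_zero, Finset.sum_const_zero] at h1
  rcases smul_eq_zero.1 h1.symm with h2 | h2
  · exact hd h2
  · exact hp0 h2

/-- The gradient of `p` is, modulo `p`, a nonzero vector in the kernel of the coefficient matrix. -/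
lemma dvd_det_of_forall_dvd {p : S} (hp : Prime p) {d : ℕ} (hhom : p.IsHomogeneous d) (hd : d ≠ 0)
    {D : Fin 3 → Derivation ℂ S S} (hD : ∀ i, p ∣ D i p) : p ∣ (coeffMatrix D).det := by
  obtain ⟨j, hj⟩ := exists_not_dvd_pderiv hhom hp.ne_zero hd
  refine (hp.dvd_or_dvd ?_).resolve_right hj
  have h : (coeffMatrix D).det * pderiv j p = ∑ i, (coeffMatrix D).adjugate j i * D i p := by
    have h1 : (coeffMatrix D).mulVec (fun k => pderiv k p) = fun i => D i p := by
      funext i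
      rw [derivation_apply_eq_sum (D i) p]
      rfl
    have h2 := congrFun (congrArg (fun M => M.mulVec (fun k => pderiv k p))
      (coeffMatrix D).adjugate_mul) j
    simp only [← Matrix.mulVec_mulVec, h1] at h2
    rw [Matrix.smul_mulVec, Matrix.one_mulVec] at h2
    simpa [Matrix.mulVec, dotProduct] using h2.symm
  rw [h]
  exact Finset.dvd_sum fun i _ => (hD i).mul_left _

section Saito

variable {ι : Type*} [Fintype ι] {p : ι → S} {d : ι → ℕ}

lemma dvd_apply_of_dvd_prod (hp : ∀ i, Prime (p i)) (hne : ∀ i j, i ≠ j → ¬ p i ∣ p j)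
    {D : Derivation ℂ S S} (hD : (∏ i, p i) ∣ D (∏ i, p i)) (i : ι) : p i ∣ D (p i) := by
  classical
  have h := Fintype.prod_eq_mul_prod_compl i p
  have h1 : p i ∣ D (∏ i, p i) := (Dvd.intro _ h.symm).trans hD
  rw [h, D.leibniz, smul_eq_mul, smul_eq_mul, dvd_add_right (Dvd.intro _ rfl)] at h1
  refine ((hp i).dvd_or_dvd h1).resolve_left fun h2 => ?_
  obtain ⟨j, hj, h3⟩ := (hp i).exists_mem_finset_dvd h2
  exact hne i j (by rintro rfl; simp at hj) h3

lemma prod_dvd_det (hp : ∀ i, Prime (p i)) (hne : ∀ i j, i ≠ j → ¬ p i ∣ p j)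
    (hhom : ∀ i, (p i).IsHomogeneous (d i)) (hd : ∀ i, d i ≠ 0)
    {D : Fin 3 → Derivation ℂ S S} (hD : ∀ k, (∏ i, p i) ∣ D k (∏ i, p i)) :
    (∏ i, p i) ∣ (coeffMatrix D).det := by
  refine Finset.prod_dvd_of_isRelPrime ?_ fun i _ =>
    dvd_det_of_forall_dvd (hp i) (hhom i) (hd i) fun k => dvd_apply_of_dvd_prod hp hne (hD k) i
  intro i _ j _ hij
  exact ((hp i).irreducible.isRelPrime_iff_not_dvd).2 (hne i j hij)

/-- Cramer's rule for the coefficients of derivations. -/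
lemma det_smul_eq (D : Fin 3 → Derivation ℂ S S) (δ : Derivation ℂ S S) :
    (coeffMatrix D).det • δ =
      ∑ k, (coeffMatrix (Function.update D k δ)).det • D k := by
  refine derivation_ext fun i => ?_
  simp only [coeffMatrix, Fin.sum_univ_three, Derivation.add_apply, Derivation.smul_apply,
    Matrix.det_fin_three, Matrix.of_apply, smul_eq_mul]
  fin_cases i <;> simp <;> ring

lemma linearIndependent_of_det_ne_zero {D : Fin 3 → Derivation ℂ S S}
    (hD : (coeffMatrix D).det ≠ 0) :
    LinearIndependent S D := by
  rw [Fintype.linearIndependent_iff]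
  intro g hg
  have h := Matrix.linearIndependent_rows_of_det_ne_zero hD
  rw [Fintype.linearIndependent_iff] at h
  refine h g (funext fun j => ?_)
  have h1 := DFunLike.congr_fun hg (X j)
  simpa [Fin.sum_univ_three, coeffMatrix] using h1

/-- Saito's criterion: derivations tangent to a reduced curve form a basis of all such derivations
as soon as their determinant is a nonzero constant multiple of the equation of the curve. -/
lemma exists_sum_smul_eq (hp : ∀ i, Prime (p i)) (hne : ∀ i j, i ≠ j → ¬ p i ∣ p j)
    (hhom : ∀ i, (p i).IsHomogeneous (d i)) (hd : ∀ i, d i ≠ 0)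
    {D : Fin 3 → Derivation ℂ S S} (hD : ∀ k, (∏ i, p i) ∣ D k (∏ i, p i))
    {c : ℂ} (hc : c ≠ 0) (hdet : (coeffMatrix D).det = C c * ∏ i, p i)
    {δ : Derivation ℂ S S} (hδ : (∏ i, p i) ∣ δ (∏ i, p i)) :
    ∃ s : Fin 3 → S, δ = ∑ k, s k • D k := by
  have hF : (∏ i, p i) ≠ 0 := Finset.prod_ne_zero_iff.2 fun i _ => (hp i).ne_zero
  have h : ∀ k, (∏ i, p i) ∣ (coeffMatrix (Function.update D k δ)).det := fun k =>
    prod_dvd_det hp hne hhom hd fun l => by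
      by_cases hl : l = k
      · subst hl; simpa using hδ
      · simpa [hl] using hD l
  choose s hs using h
  refine ⟨fun k => C c⁻¹ * s k, derivation_ext fun j => mul_left_cancel₀ hF ?_⟩
  have h1 := DFunLike.congr_fun (det_smul_eq D δ) (X j)
  have hcc : (C c⁻¹ : S) * C c = 1 := by rw [← C_mul, inv_mul_cancel₀ hc, C_1]
  simp only [hdet, hs, Fin.sum_univ_three, Derivation.add_apply, Derivation.smul_apply,
    smul_eq_mul] at h1 ⊢
  linear_combination C c⁻¹ * h1 - (∏ i, p i) * δ (X j) * hcc

/-- Freeness and exponents of a reduced curve from two homogeneous Jacobian syzygies which, together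
with the Euler derivation, satisfy Saito's criterion. -/
theorem isFreeCurve_and_hasExponents (hp : ∀ i, Prime (p i)) (hne : ∀ i j, i ≠ j → ¬ p i ∣ p j)
    (hhom : ∀ i, (p i).IsHomogeneous (d i)) (hd : ∀ i, d i ≠ 0) {n : ℕ} (hn : n ≠ 0)
    (hF : (∏ i, p i).IsHomogeneous n) {θ₁ θ₂ : Derivation ℂ S S} {d₁ d₂ : ℕ}
    (h₁ : θ₁ (∏ i, p i) = 0) (h₂ : θ₂ (∏ i, p i) = 0)
    (hd₁ : ∀ j, (θ₁ (X j)).IsHomogeneous d₁) (hd₂ : ∀ j, (θ₂ (X j)).IsHomogeneous d₂)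
    {c : ℂ} (hc : c ≠ 0) (hdet : (coeffMatrix ![euler, θ₁, θ₂]).det = C c * ∏ i, p i) :
    IsFreeCurve (∏ i, p i) ∧ HasExponents (∏ i, p i) d₁ d₂ := by
  set F := ∏ i, p i with hFdef
  have hF0 : F ≠ 0 := Finset.prod_ne_zero_iff.2 fun i _ => (hp i).ne_zero
  have hEF : euler F = n • F := euler_apply hF
  have hD : ∀ k, F ∣ (![euler, θ₁, θ₂] : Fin 3 → Derivation ℂ S S) k F := by
    intro k
    fin_cases k
    · simp [hEF]
    · simp [h₁]
    · simp [h₂]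
  have hdet0 : (coeffMatrix ![euler, θ₁, θ₂]).det ≠ 0 := by
    rw [hdet]
    exact mul_ne_zero (by simpa using hc) hF0
  have hli := linearIndependent_of_det_ne_zero hdet0
  have hgen := fun (δ : Derivation ℂ S S) (hδ : F ∣ δ F) =>
    exists_sum_smul_eq hp hne hhom hd hD hc hdet hδ
  constructor
  · let b : Module.Basis (Fin 3) S (tangentDer F) := Module.Basis.mk
      (v := fun k => ⟨(![euler, θ₁, θ₂] : Fin 3 → Derivation ℂ S S) k,
        Ideal.mem_span_singleton.2 (hD k)⟩)
      (LinearIndependent.of_comp (tangentDer F).subtype hli) (by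
        rintro ⟨δ, hδ⟩ -
        obtain ⟨s, hs⟩ := hgen δ (Ideal.mem_span_singleton.1 hδ)
        rw [Submodule.mem_span_range_iff_exists_fun]
        exact ⟨s, Subtype.ext (by simpa [Fin.sum_univ_three] using hs.symm)⟩)
    exact Module.Free.of_basis b
  · have hli' : LinearIndependent S ![θ₁, θ₂] := by
      have := hli.comp (Fin.succ) (Fin.succ_injective 2)
      convert this using 1
      funext k
      fin_cases k <;> rfl
    have hmem : ∀ k, (![θ₁, θ₂] : Fin 2 → Derivation ℂ S S) k ∈ jacobianSyz F := by
      intro k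
      fin_cases k
      · exact h₁
      · exact h₂
    let b : Module.Basis (Fin 2) S (jacobianSyz F) := Module.Basis.mk
      (v := fun k => ⟨(![θ₁, θ₂] : Fin 2 → Derivation ℂ S S) k, hmem k⟩)
      (LinearIndependent.of_comp (jacobianSyz F).subtype hli') (by
        rintro ⟨δ, hδ⟩ -
        have hδ' : δ F = 0 := hδ
        obtain ⟨s, hs⟩ := hgen δ (hδ' ▸ dvd_zero F)
        have h0 : s 0 = 0 := by
          have h := DFunLike.congr_fun hs F
          simp only [hδ', Fin.sum_univ_three, Derivation.add_apply, Derivation.smul_apply,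
            Matrix.cons_val, hEF, h₁, h₂, smul_zero, add_zero] at h
          simpa [hn, hF0] using h.symm
        rw [Submodule.mem_span_range_iff_exists_fun]
        refine ⟨![s 1, s 2], Subtype.ext ?_⟩
        simpa [Fin.sum_univ_three, h0] using hs.symm)
    refine ⟨b, fun j => ?_, fun j => ?_⟩
    · simpa [b] using hd₁ j
    · simpa [b] using hd₂ j

end Saito

/-- A nonzero constant factor of the equation does not matter. -/
lemma isFreeCurve_and_hasExponents_C_mul {F : S} {c : ℂ} (hc : c ≠ 0) {d₁ d₂ : ℕ}
    (h : IsFreeCurve F ∧ HasExponents F d₁ d₂) :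
    IsFreeCurve (C c * F) ∧ HasExponents (C c * F) d₁ d₂ := by
  have hu : IsUnit (C c : S) := (isUnit_iff_ne_zero.2 hc).map C
  have hspan : Ideal.span {C c * F} = Ideal.span {F} := Ideal.span_singleton_mul_left_unit hu F
  have h1 : tangentDer (C c * F) = tangentDer F := by
    ext θ
    change θ (C c * F) ∈ Ideal.span {C c * F} ↔ θ F ∈ Ideal.span {F}
    rw [hspan, ← smul_eq_C_mul, Derivation.map_smul, smul_eq_C_mul]
    exact Ideal.unit_mul_mem_iff_mem _ hu
  have h2 : jacobianSyz (C c * F) = jacobianSyz F := by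
    ext θ
    change θ (C c * F) = 0 ↔ θ F = 0
    rw [← smul_eq_C_mul, Derivation.map_smul, smul_eq_zero_iff_right hc]
  unfold IsFreeCurve HasExponents
  rwa [h1, h2]

/-! ### Quadratic forms in three variables -/

/-- The quadratic form `a x₀² + b x₁² + c x₂² + d x₁x₂ + e x₀x₂ + f x₀x₁`. -/
noncomputable def quad (a b c d e f : ℂ) : S :=
  C a * X 0 ^ 2 + C b * X 1 ^ 2 + C c * X 2 ^ 2 +
    C d * (X 1 * X 2) + C e * (X 0 * X 2) + C f * (X 0 * X 1)

@[simp]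
lemma eval_quad (a b c d e f : ℂ) (v : Fin 3 → ℂ) : eval v (quad a b c d e f) =
    a * v 0 ^ 2 + b * v 1 ^ 2 + c * v 2 ^ 2 +
      d * (v 1 * v 2) + e * (v 0 * v 2) + f * (v 0 * v 1) := by
  simp [quad]

lemma quad_isHomogeneous (a b c d e f : ℂ) : (quad a b c d e f).IsHomogeneous 2 := by
  have h (i : Fin 3) (r : ℂ) : (C r * X i ^ 2 : S).IsHomogeneous 2 := by
    simpa using (isHomogeneous_C (Fin 3) r).mul ((isHomogeneous_X ℂ i).pow 2)
  have h' (i j : Fin 3) (r : ℂ) : (C r * (X i * X j) : S).IsHomogeneous 2 := by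
    simpa using (isHomogeneous_C (Fin 3) r).mul ((isHomogeneous_X ℂ i).mul (isHomogeneous_X ℂ j))
  exact (((((h _ _).add (h _ _)).add (h _ _)).add (h' _ _ _)).add (h' _ _ _)).add (h' _ _ _)

lemma exists_eq_C_of_isHomogeneous_zero {p : S} (hp : p.IsHomogeneous 0) : ∃ a, p = C a :=
  ⟨_, totalDegree_eq_zero_iff_eq_C.1 (Nat.le_zero.1 hp.totalDegree_le)⟩

lemma exists_eq_linear {p : S} (hp : p.IsHomogeneous 1) :
    ∃ a b c, p = C a * X 0 + C b * X 1 + C c * X 2 := by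
  have h (i : Fin 3) : ∃ a, pderiv i p = C a := exists_eq_C_of_isHomogeneous_zero hp.pderiv
  choose a ha using h
  refine ⟨a 0, a 1, a 2, ?_⟩
  have h1 := hp.sum_X_mul_pderiv
  simp only [ha, Fin.sum_univ_three, one_smul] at h1
  linear_combination -h1

lemma exists_eq_quad {p : S} (hp : p.IsHomogeneous 2) :
    ∃ a b c d e f, p = quad a b c d e f := by
  have h (i : Fin 3) : ∃ a b c, pderiv i p = C a * X 0 + C b * X 1 + C c * X 2 :=
    exists_eq_linear hp.pderiv
  choose a b c h using h
  refine ⟨1 / 2 * a 0, 1 / 2 * b 1, 1 / 2 * c 2, 1 / 2 * (c 1 + b 2), 1 / 2 * (c 0 + a 2),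
    1 / 2 * (b 0 + a 1), ?_⟩
  have h1 := hp.sum_X_mul_pderiv
  have h2 : (C (1 / 2) : S) * 2 = 1 := by
    rw [show (2 : S) = C 2 from (map_ofNat C 2).symm, ← C_mul]
    norm_num
  simp only [h, Fin.sum_univ_three, nsmul_eq_mul] at h1
  simp only [quad, C_mul, C_add]
  push_cast at h1
  linear_combination -C (1 / 2) * h1 - p * h2

lemma exists_eval_eq_of_totalDegree_le_one {p : S} (hp : p.totalDegree ≤ 1) :
    ∃ k a b c, ∀ v, eval v p = k + (a * v 0 + b * v 1 + c * v 2) := by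
  obtain ⟨k, hk⟩ := exists_eq_C_of_isHomogeneous_zero (homogeneousComponent_isHomogeneous 0 p)
  obtain ⟨a, b, c, h⟩ := exists_eq_linear (homogeneousComponent_isHomogeneous 1 p)
  refine ⟨k, a, b, c, fun v => ?_⟩
  have h1 : p = homogeneousComponent 0 p + homogeneousComponent 1 p := by
    conv_lhs => rw [← sum_homogeneousComponent p]
    have h2 : Finset.range (p.totalDegree + 1) ⊆ Finset.range 2 :=
      Finset.range_mono (by omega)
    rw [Finset.sum_subset h2, Finset.sum_range_succ, Finset.sum_range_one]
    intro i _ hi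
    exact homogeneousComponent_eq_zero _ _ (by simpa using hi)
  rw [h1, hk, h]
  simp

/-- A reducible quadratic form is a product of two linear forms, so its discriminant vanishes. -/
lemma quad_prime {a b c d e f : ℂ}
    (h : 4 * a * b * c + d * e * f - a * d ^ 2 - b * e ^ 2 - c * f ^ 2 ≠ 0) :
    Prime (quad a b c d e f) := by
  have h0 : quad a b c d e f ≠ 0 := by
    intro h0
    have hv (v : Fin 3 → ℂ) := (eval_quad a b c d e f v).symm.trans (by rw [h0, map_zero])
    have ha : a = 0 := by simpa using hv ![1, 0, 0]
    have hb : b = 0 := by simpa using hv ![0, 1, 0]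
    have hc : c = 0 := by simpa using hv ![0, 0, 1]
    have hd : d = 0 := by simpa [hb, hc] using hv ![0, 1, 1]
    exact h (by simp [ha, hb, hc, hd])
  have hdeg := (quad_isHomogeneous a b c d e f).totalDegree h0
  refine Irreducible.prime ⟨fun hu => ?_, fun u w huw => ?_⟩
  · rw [(MvPolynomial.isUnit_iff_totalDegree_of_isReduced.1 hu).2] at hdeg
    omega
  · have hu0 : u ≠ 0 := by rintro rfl; simp [h0] at huw
    have hw0 : w ≠ 0 := by rintro rfl; simp [h0] at huw
    have hunit {z : S} (hz : z ≠ 0) (hz0 : z.totalDegree = 0) : IsUnit z := by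
      rw [totalDegree_eq_zero_iff_eq_C] at hz0
      rw [hz0] at hz ⊢
      exact (isUnit_iff_ne_zero.2 (by simpa using hz)).map C
    rw [huw, totalDegree_mul_of_isDomain hu0 hw0] at hdeg
    by_contra! hnu
    have hu1 : u.totalDegree ≠ 0 := fun h => hnu.1 (hunit hu0 h)
    have hw1 : w.totalDegree ≠ 0 := fun h => hnu.2 (hunit hw0 h)
    obtain ⟨k, u0, u1, u2, hu⟩ :=
      exists_eval_eq_of_totalDegree_le_one (p := u) (by omega)
    obtain ⟨l, w0, w1, w2, hw⟩ :=
      exists_eval_eq_of_totalDegree_le_one (p := w) (by omega)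
    have hv (x y z : ℂ) : a * x ^ 2 + b * y ^ 2 + c * z ^ 2 + d * (y * z) + e * (x * z) +
        f * (x * y) = (u0 * x + u1 * y + u2 * z) * (w0 * x + w1 * y + w2 * z) := by
      -- The average of the values at `v` and `-v`, less the value at `0`, isolates the product of
      -- the linear parts of the two factors.
      have e1 (v : Fin 3 → ℂ) := congrArg (eval v) huw
      simp only [map_mul, eval_quad, hu, hw] at e1
      have e2 := e1 ![x, y, z]
      have e3 := e1 ![-x, -y, -z]
      have e4 := e1 ![0, 0, 0]
      simp only [Matrix.cons_val] at e2 e3 e4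
      linear_combination e2 / 2 + e3 / 2 - e4
    have ha := hv 1 0 0
    have hb := hv 0 1 0
    have hc := hv 0 0 1
    have hd := hv 0 1 1
    have he := hv 1 0 1
    have hf := hv 1 1 0
    simp only [mul_zero, add_zero, zero_add, mul_one, one_pow, ne_eq,
      OfNat.ofNat_ne_zero, not_false_eq_true, zero_pow] at ha hb hc hd he hf
    have hd' : d = u1 * w2 + u2 * w1 := by linear_combination hd - hb - hc
    have he' : e = u0 * w2 + u2 * w0 := by linear_combination he - ha - hc
    have hf' : f = u0 * w1 + u1 * w0 := by linear_combination hf - ha - hb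
    apply h
    rw [ha, hb, hc, hd', he', hf']
    ring

/-! ### The conics through six of the nine points -/

section Conics

variable {ω t : ℂ}

/-- The additive character `a ↦ ω ^ a` of `ZMod 3`. -/
noncomputable def cubeChar (hω : IsPrimitiveRoot ω 3) : AddChar (ZMod 3) ℂ :=
  AddChar.zmodChar 3 hω.pow_eq_one

lemma cubeChar_apply (hω : IsPrimitiveRoot ω 3) (a : ZMod 3) : cubeChar hω a = ω ^ a.val :=
  AddChar.zmodChar_apply _ a

lemma cubeChar_pow_three (hω : IsPrimitiveRoot ω 3) (a : ZMod 3) : cubeChar hω a ^ 3 = 1 := by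
  rw [cubeChar_apply, ← pow_mul, mul_comm, pow_mul, hω.pow_eq_one, one_pow]

lemma cubeChar_ne_zero (hω : IsPrimitiveRoot ω 3) (a : ZMod 3) : cubeChar hω a ≠ 0 := by
  intro h
  simpa [h] using cubeChar_pow_three hω a

lemma cubeChar_eq_one_iff (hω : IsPrimitiveRoot ω 3) {a : ZMod 3} :
    cubeChar hω a = 1 ↔ a = 0 := by
  rw [cubeChar_apply, hω.pow_eq_one_iff_dvd, ← ZMod.natCast_eq_zero_iff]
  simp

lemma exists_cubeChar_eq (hω : IsPrimitiveRoot ω 3) {r : ℂ} (hr : r ^ 3 = 1) :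
    ∃ a, cubeChar hω a = r := by
  obtain ⟨i, hi, rfl⟩ := hω.eq_pow_of_pow_eq_one hr
  exact ⟨i, by rw [cubeChar_apply, ZMod.val_natCast_of_lt hi]⟩

lemma one_add_add_sq_eq_zero (hω : IsPrimitiveRoot ω 3) : 1 + ω + ω ^ 2 = 0 := by
  have h := hω.geom_sum_eq_zero (by norm_num)
  simpa [Finset.sum_range_succ] using h

lemma zmodThree_cases : ∀ a : ZMod 3, a = 0 ∨ a = 1 ∨ a = 2 := by decide

/-- The points of the arrangement, with an arbitrary number `r` in the role of `ω ^ b`. -/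
def orbitPoint (τ r : ℂ) (a : ZMod 3) : Fin 3 → ℂ :=
  fun i => r ^ i.val * (if i.val = a.val then τ else 1)

/-- The image under `diag(1, μ⁻¹, ν⁻¹)` of the conic
`x₀² + x₁² + x₂² + (τ + 1)(x₁x₂ + x₀x₂ + x₀x₁) = 0`. The latter contains the points
`orbitPoint τ r a` for both nontrivial cube roots of unity `r`. -/
noncomputable def orbitConic (τ μ ν : ℂ) : S :=
  quad 1 (μ ^ 2) (ν ^ 2) ((τ + 1) * (μ * ν)) ((τ + 1) * ν) ((τ + 1) * μ)

/-- The conic of the line `b + k a = s` in the affine plane. -/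
noncomputable def slopeConic (hω : IsPrimitiveRoot ω 3) (t : ℂ) (k s : ZMod 3) : S :=
  orbitConic (cubeChar hω k * t) (cubeChar hω (2 * k + 2 * s)) (cubeChar hω (2 * k + s))

/-- The conic of the line `a = d` in the affine plane; its equation is `t x_d² - x_i x_j` for
the two remaining indices `i` and `j`. -/
noncomputable def verticalConic (t : ℂ) (d : ZMod 3) : S :=
  quad (if d = 0 then t else 0) (if d = 1 then t else 0) (if d = 2 then t else 0)
    (if d = 0 then -1 else 0) (if d = 1 then -1 else 0) (if d = 2 then -1 else 0)

/-- The Chilean family of conics with normalized equations. -/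
noncomputable def stdConic (hω : IsPrimitiveRoot ω 3) (t : ℂ) (l : Fin 4 × ZMod 3) : S :=
  ![verticalConic t l.2, slopeConic hω t 0 l.2, slopeConic hω t 1 l.2,
    slopeConic hω t 2 (2 * l.2)] l.1

lemma point_eq_orbitPoint (hω : IsPrimitiveRoot ω 3) (v : ZMod 3 × ZMod 3) :
    point ω t v = orbitPoint t (cubeChar hω v.2) v.1 := by
  funext i
  simp [point, orbitPoint, cubeChar_apply, pow_mul]

/-- A diagonal map carries the nine points to those for `ω ^ k t` in place of `t`, and the lines
`b + k a = s` to the lines `b = 0`. -/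
lemma rescale_point (hω : IsPrimitiveRoot ω 3) (k s : ZMod 3) (v : ZMod 3 × ZMod 3) (i : Fin 3) :
    ![1, cubeChar hω (2 * k + 2 * s), cubeChar hω (2 * k + s)] i * point ω t v i =
      (if v.1 = 0 then cubeChar hω k ^ 2 else 1) *
        orbitPoint (cubeChar hω k * t) (cubeChar hω (v.2 + k * v.1 + 2 * s)) v.1 i := by
  obtain ⟨a, b⟩ := v
  have hk := cubeChar_pow_three hω k
  have hs := cubeChar_pow_three hω s
  rw [point_eq_orbitPoint hω]
  generalize hK : cubeChar hω k = K at *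
  generalize hS : cubeChar hω s = R at *
  generalize hB : cubeChar hω b = B at *
  have hz : (2 : ZMod 3) ≠ 0 := by decide
  have hv2 : (2 : ZMod 3).val = 2 := rfl
  have hv1 : (1 : ZMod 3).val = 1 := rfl
  rcases zmodThree_cases a with rfl | rfl | rfl <;> fin_cases i <;>
    simp [orbitPoint, two_mul, mul_two, AddChar.map_add_eq_mul, hK, hS, hB, hv1, hv2, hz] <;>
    grind

lemma eval_orbitConic (τ μ ν : ℂ) (v : Fin 3 → ℂ) : eval v (orbitConic τ μ ν) =
    eval (fun i => ![1, μ, ν] i * v i) (orbitConic τ 1 1) := by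
  simp [orbitConic]
  ring

lemma eval_orbitPoint {τ r : ℂ} (hr : r ^ 3 = 1) (a : ZMod 3) :
    eval (orbitPoint τ r a) (orbitConic τ 1 1) =
      r ^ (2 * a.val) * (τ ^ 2 + (r + r ^ 2) + (τ + 1) * (τ * (r + r ^ 2) + 1)) := by
  have hv2 : (2 : ZMod 3).val = 2 := rfl
  have hv1 : (1 : ZMod 3).val = 1 := rfl
  rcases zmodThree_cases a with rfl | rfl | rfl <;>
    simp [orbitConic, orbitPoint, hv1, hv2] <;> grind

lemma eval_orbitPoint_eq_zero_iff {τ r : ℂ} (hτ : τ ^ 3 ≠ 1) (hr : r ^ 3 = 1) (a : ZMod 3) :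
    eval (orbitPoint τ r a) (orbitConic τ 1 1) = 0 ↔ r ≠ 1 := by
  have hr0 : r ≠ 0 := by rintro rfl; norm_num at hr
  rw [eval_orbitPoint hr, mul_eq_zero_iff_left (pow_ne_zero _ hr0)]
  constructor
  · rintro h rfl
    exact hτ (by linear_combination (τ - 1) / 3 * h)
  · intro h
    have h1 : 1 + r + r ^ 2 = 0 :=
      mul_left_cancel₀ (sub_ne_zero.2 h) (by linear_combination hr)
    linear_combination (1 + τ * (τ + 1)) * h1

lemma eval_const_mul {p : S} (hp : p.IsHomogeneous 2) (c : ℂ) (v : Fin 3 → ℂ) :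
    eval (fun i => c * v i) p = c ^ 2 * eval v p := by
  obtain ⟨_, _, _, _, _, _, rfl⟩ := exists_eq_quad hp
  simp only [eval_quad]
  ring

lemma eval_slopeConic_eq_zero_iff (hω : IsPrimitiveRoot ω 3) (h1 : t ^ 3 ≠ 1) (k s : ZMod 3)
    (v : ZMod 3 × ZMod 3) :
    eval (point ω t v) (slopeConic hω t k s) = 0 ↔ v.2 + k * v.1 + 2 * s ≠ 0 := by
  have hc : (if v.1 = 0 then cubeChar hω k ^ 2 else 1) ≠ 0 := by
    split_ifs
    · exact pow_ne_zero _ (cubeChar_ne_zero hω k)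
    · exact one_ne_zero
  rw [slopeConic, eval_orbitConic, funext (rescale_point hω k s v),
    eval_const_mul (p := orbitConic _ _ _) (quad_isHomogeneous _ _ _ _ _ _),
    mul_eq_zero_iff_left (pow_ne_zero _ hc),
    eval_orbitPoint_eq_zero_iff _ (cubeChar_pow_three hω _), ne_eq, cubeChar_eq_one_iff]
  rwa [mul_pow, cubeChar_pow_three, one_mul]

lemma eval_verticalConic_eq_zero_iff (hω : IsPrimitiveRoot ω 3) (h1 : t ^ 3 ≠ 1) (d : ZMod 3)
    (v : ZMod 3 × ZMod 3) :
    eval (point ω t v) (verticalConic t d) = 0 ↔ v.1 ≠ d := by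
  obtain ⟨a, b⟩ := v
  have hb := cubeChar_pow_three hω b
  have hb0 := cubeChar_ne_zero hω b
  rw [point_eq_orbitPoint hω]
  generalize cubeChar hω b = B at *
  have hv2 : (2 : ZMod 3).val = 2 := rfl
  have hv1 : (1 : ZMod 3).val = 1 := rfl
  have hz2 : (2 : ZMod 3) ≠ 0 := by decide
  have hz21 : (2 : ZMod 3) ≠ 1 := by decide
  have hz12 : (1 : ZMod 3) ≠ 2 := by decide
  have hz02 : (0 : ZMod 3) ≠ 2 := by decide
  rcases zmodThree_cases a with rfl | rfl | rfl <;> rcases zmodThree_cases d with rfl | rfl | rfl <;>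
    simp [verticalConic, orbitPoint, hv1, hv2, hz2, hz21, hz12, hz02] <;> grind

lemma mem_affLine_zero (d : ZMod 3) (v : ZMod 3 × ZMod 3) : v ∈ affLine (0, d) ↔ v.1 = d := by
  simp [affLine, normal]

lemma mem_affLine_one (d : ZMod 3) (v : ZMod 3 × ZMod 3) :
    v ∈ affLine (1, d) ↔ v.2 + 0 * v.1 + 2 * d = 0 := by
  simp only [affLine, normal, Set.mem_ofPred_eq, Matrix.cons_val]
  revert d v; decide

lemma mem_affLine_two (d : ZMod 3) (v : ZMod 3 × ZMod 3) :
    v ∈ affLine (2, d) ↔ v.2 + 1 * v.1 + 2 * d = 0 := by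
  simp only [affLine, normal, Set.mem_ofPred_eq, Matrix.cons_val]
  revert d v; decide

lemma mem_affLine_three (d : ZMod 3) (v : ZMod 3 × ZMod 3) :
    v ∈ affLine (3, d) ↔ v.2 + 2 * v.1 + 2 * (2 * d) = 0 := by
  simp only [affLine, normal, Set.mem_ofPred_eq, Matrix.cons_val]
  revert d v; decide

lemma exists_mem_affLine (l : Fin 4 × ZMod 3) : ∃ v, v ∈ affLine l := by
  simp only [affLine, Set.mem_ofPred_eq]
  revert l; decide

lemma eq_of_affLine_subset {l m : Fin 4 × ZMod 3} (h : affLine l ⊆ affLine m) : l = m := by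
  simp only [affLine, Set.ofPred_subset_ofPred] at h
  revert l m; decide

theorem stdConic_isChilean (hω : IsPrimitiveRoot ω 3) (h1 : t ^ 3 ≠ 1) :
    IsChilean ω t (stdConic hω t) := by
  rintro ⟨j, d⟩
  fin_cases j
  · exact ⟨quad_isHomogeneous _ _ _ _ _ _, fun v =>
      (eval_verticalConic_eq_zero_iff hω h1 d v).trans (mem_affLine_zero d v).not.symm⟩
  · exact ⟨quad_isHomogeneous _ _ _ _ _ _, fun v =>
      (eval_slopeConic_eq_zero_iff hω h1 0 d v).trans (mem_affLine_one d v).not.symm⟩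
  · exact ⟨quad_isHomogeneous _ _ _ _ _ _, fun v =>
      (eval_slopeConic_eq_zero_iff hω h1 1 d v).trans (mem_affLine_two d v).not.symm⟩
  · exact ⟨quad_isHomogeneous _ _ _ _ _ _, fun v =>
      (eval_slopeConic_eq_zero_iff hω h1 2 (2 * d) v).trans (mem_affLine_three d v).not.symm⟩

/-- On the points `orbitPoint τ r i` with `r ^ 3 = 1`, a quadratic form is a quadratic polynomial
in `r`. -/
lemma eval_orbitPoint_quad (τ a b c d e f : ℂ) {r : ℂ} (hr : r ^ 3 = 1) :
    eval (orbitPoint τ r 0) (quad a b c d e f) =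
        (a * τ ^ 2 + d) + (c + τ * f) * r + (b + τ * e) * r ^ 2 ∧
      eval (orbitPoint τ r 1) (quad a b c d e f) =
        (a + τ * d) + (c + τ * f) * r + (b * τ ^ 2 + e) * r ^ 2 ∧
      eval (orbitPoint τ r 2) (quad a b c d e f) =
        (a + τ * d) + (c * τ ^ 2 + f) * r + (b + τ * e) * r ^ 2 := by
  have hv2 : (2 : ZMod 3).val = 2 := rfl
  have hv1 : (1 : ZMod 3).val = 1 := rfl
  refine ⟨?_, ?_, ?_⟩ <;> simp [orbitPoint, hv1, hv2]
  · linear_combination (c * r + d) * hr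
  · linear_combination (c * r + d * τ) * hr
  · linear_combination (c * τ ^ 2 * r + d * τ) * hr

/-- A polynomial of degree at most two which vanishes at `ω` and `ω²` is a multiple of
`1 + r + r²`, so its three coefficients agree. -/
lemma coeff_eq_of_eval_eq_zero (hω : IsPrimitiveRoot ω 3) {u v w : ℂ}
    (h : ∀ r, r ^ 3 = 1 → r ≠ 1 → u + v * r + w * r ^ 2 = 0) : v = u ∧ w = u := by
  have hw := one_add_add_sq_eq_zero hω
  have hne : ω ≠ 1 := hω.ne_one (by norm_num)
  have h3 := hω.pow_eq_one
  have e1 := h ω h3 hne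
  have e2 := h (ω ^ 2) (by rw [← pow_mul, mul_comm, pow_mul, h3, one_pow])
    (hω.pow_ne_one_of_pos_of_lt (by norm_num) (by norm_num))
  have hd : ω ^ 2 - ω ≠ 0 := by
    intro h0
    exact mul_ne_zero (hω.ne_zero (by norm_num)) (sub_ne_zero.2 hne) (by linear_combination h0)
  have hvw : v = w := mul_left_cancel₀ hd (by linear_combination e2 - e1 - w * ω * h3)
  subst hvw
  have : v = u := by linear_combination -e1 + v * hw
  exact ⟨this, this⟩

/-- Uniqueness of the conic through the six points `orbitPoint τ r a` with `r ^ 2 + r + 1 = 0`. -/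
lemma coeff_eq_of_eval_orbitPoint (hω : IsPrimitiveRoot ω 3) {τ a b c d e f : ℂ} (hτ : τ ^ 3 ≠ 1)
    (h : ∀ r, r ^ 3 = 1 → r ≠ 1 → ∀ i, eval (orbitPoint τ r i) (quad a b c d e f) = 0) :
    b = a ∧ c = a ∧ d = (τ + 1) * a ∧ e = (τ + 1) * a ∧ f = (τ + 1) * a := by
  obtain ⟨k1, k2⟩ := coeff_eq_of_eval_eq_zero hω fun r hr hr1 =>
    (eval_orbitPoint_quad τ a b c d e f hr).1.symm.trans (h r hr hr1 0)
  obtain ⟨k3, k4⟩ := coeff_eq_of_eval_eq_zero hω fun r hr hr1 =>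
    (eval_orbitPoint_quad τ a b c d e f hr).2.1.symm.trans (h r hr hr1 1)
  obtain ⟨k5, k6⟩ := coeff_eq_of_eval_eq_zero hω fun r hr hr1 =>
    (eval_orbitPoint_quad τ a b c d e f hr).2.2.symm.trans (h r hr hr1 2)
  have hτ1 : τ - 1 ≠ 0 := by
    intro h0
    exact hτ (by rw [sub_eq_zero.1 h0, one_pow])
  have hτ2 : τ ^ 2 + τ + 1 ≠ 0 := fun h0 => hτ (by linear_combination (τ - 1) * h0)
  have hd : d = (τ + 1) * a := mul_left_cancel₀ hτ1 (by linear_combination k1 - k3)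
  have he : e = (τ + 1) * b := mul_left_cancel₀ hτ1 (by linear_combination k6 - k4)
  have hf : f = (τ + 1) * c := mul_left_cancel₀ hτ1 (by linear_combination k3 - k5)
  have hb : b = a := mul_left_cancel₀ hτ2 (by linear_combination k6 + τ * hd - τ * he)
  have hc : c = a := mul_left_cancel₀ hτ2 (by linear_combination k3 + τ * hd - τ * hf)
  exact ⟨hb, hc, hd, hb ▸ he, hc ▸ hf⟩

lemma exists_eq_C_mul_slopeConic (hω : IsPrimitiveRoot ω 3) (h1 : t ^ 3 ≠ 1) {k s : ZMod 3}
    {p : S} (hp : p.IsHomogeneous 2)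
    (h : ∀ v : ZMod 3 × ZMod 3, v.2 + k * v.1 + 2 * s ≠ 0 → eval (point ω t v) p = 0) :
    ∃ c, p = C c * slopeConic hω t k s := by
  obtain ⟨a, b, c, d, e, f, rfl⟩ := exists_eq_quad hp
  set μ := cubeChar hω (2 * k + 2 * s) with hμ
  set ν := cubeChar hω (2 * k + s) with hν
  have hμ3 : μ ^ 3 = 1 := cubeChar_pow_three hω _
  have hν3 : ν ^ 3 = 1 := cubeChar_pow_three hω _
  have hq (v : Fin 3 → ℂ) : eval v (quad a b c d e f) = eval (fun i => ![1, μ, ν] i * v i)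
      (quad a (b * μ) (c * ν) (d * (μ ^ 2 * ν ^ 2)) (e * ν ^ 2) (f * μ ^ 2)) := by
    simp only [eval_quad, Matrix.cons_val]
    grind
  obtain ⟨hb, hc, hd, he, hf⟩ := coeff_eq_of_eval_orbitPoint hω (τ := cubeChar hω k * t)
      (a := a) (b := b * μ) (c := c * ν) (d := d * (μ ^ 2 * ν ^ 2)) (e := e * ν ^ 2)
      (f := f * μ ^ 2) (by rwa [mul_pow, cubeChar_pow_three, one_mul]) (by
    intro r hr hr1 i
    obtain ⟨b', rfl⟩ := exists_cubeChar_eq hω hr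
    rw [ne_eq, cubeChar_eq_one_iff] at hr1
    have hbi : b' - k * i - 2 * s + k * i + 2 * s = b' := by ring
    have h2 := h (i, b' - k * i - 2 * s) (by simpa only [hbi] using hr1)
    rw [hq, funext (rescale_point hω k s _), eval_const_mul (quad_isHomogeneous _ _ _ _ _ _)] at h2
    simp only [hbi] at h2
    refine (mul_eq_zero.1 h2).resolve_left (pow_ne_zero _ ?_)
    split_ifs
    · exact pow_ne_zero _ (cubeChar_ne_zero hω k)
    · exact one_ne_zero)
  refine ⟨a, ?_⟩
  have hb' : b = a * μ ^ 2 := by linear_combination μ ^ 2 * hb - b * hμ3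
  have hc' : c = a * ν ^ 2 := by linear_combination ν ^ 2 * hc - c * hν3
  have hd' : d = a * ((cubeChar hω k * t + 1) * (μ * ν)) := by grind
  have he' : e = a * ((cubeChar hω k * t + 1) * ν) := by grind
  have hf' : f = a * ((cubeChar hω k * t + 1) * μ) := by grind
  rw [hb', hc', hd', he', hf']
  simp only [slopeConic, orbitConic, quad, ← hμ, ← hν, C_mul, C_1]
  ring

lemma exists_eq_C_mul_verticalConic (hω : IsPrimitiveRoot ω 3) (h1 : t ^ 3 ≠ 1) {m : ZMod 3}
    {p : S} (hp : p.IsHomogeneous 2)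
    (h : ∀ v : ZMod 3 × ZMod 3, v.1 ≠ m → eval (point ω t v) p = 0) :
    ∃ c, p = C c * verticalConic t m := by
  obtain ⟨a, b, c, d, e, f, rfl⟩ := exists_eq_quad hp
  have h' (i : ZMod 3) (hi : i ≠ m) (r : ℂ) (hr : r ^ 3 = 1) :
      eval (orbitPoint t r i) (quad a b c d e f) = 0 := by
    obtain ⟨b', rfl⟩ := exists_cubeChar_eq hω hr
    simpa only [point_eq_orbitPoint hω] using h (i, b') hi
  have key {u v w : ℂ} (h : ∀ r, r ^ 3 = 1 → u + v * r + w * r ^ 2 = 0) :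
      u = 0 ∧ v = 0 ∧ w = 0 := by
    obtain ⟨hv, hw⟩ := coeff_eq_of_eval_eq_zero hω fun r hr _ => h r hr
    have h0 := h 1 (one_pow 3)
    have hu : u = 0 := by linear_combination h0 / 3 - hv / 3 - hw / 3
    exact ⟨hu, hv.trans hu, hw.trans hu⟩
  have hz (r : ℂ) (hr : r ^ 3 = 1) := eval_orbitPoint_quad t a b c d e f hr
  have k0 (h0 : 0 ≠ m) := key fun r hr => (hz r hr).1.symm.trans (h' 0 h0 r hr)
  have k1 (h0 : 1 ≠ m) := key fun r hr => (hz r hr).2.1.symm.trans (h' 1 h0 r hr)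
  have k2 (h0 : 2 ≠ m) := key fun r hr => (hz r hr).2.2.symm.trans (h' 2 h0 r hr)
  have ht : t ^ 3 - 1 ≠ 0 := sub_ne_zero.2 h1
  have hz2 : (2 : ZMod 3) ≠ 0 := by decide
  have hz21 : (2 : ZMod 3) ≠ 1 := by decide
  have hz02 : (0 : ZMod 3) ≠ 2 := by decide
  have hz12 : (1 : ZMod 3) ≠ 2 := by decide
  rcases zmodThree_cases m with rfl | rfl | rfl
  · obtain ⟨e1, e2, e3⟩ := k1 (by decide)
    obtain ⟨-, e5, e6⟩ := k2 (by decide)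
    have hc : c = 0 := mul_left_cancel₀ ht (by linear_combination t * e5 - e2)
    have hb : b = 0 := mul_left_cancel₀ ht (by linear_combination t * e3 - e6)
    have hf : f = 0 := by linear_combination e5 - t ^ 2 * hc
    have he : e = 0 := by linear_combination e3 - t ^ 2 * hb
    have ha : a = -d * t := by linear_combination e1
    refine ⟨-d, ?_⟩
    simp only [verticalConic, quad, ha, hb, hc, he, hf]
    simp [hz02]
    ring
  · obtain ⟨e1, e2, e3⟩ := k0 (by decide)
    obtain ⟨e4, e5, e6⟩ := k2 (by decide)
    have hc : c = 0 := mul_left_cancel₀ ht (by linear_combination t * e5 - e2)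
    have ha : a = 0 := mul_left_cancel₀ ht (by linear_combination t * e1 - e4)
    have hf : f = 0 := by linear_combination e5 - t ^ 2 * hc
    have hd : d = 0 := by linear_combination e1 - t ^ 2 * ha
    have hb : b = -e * t := by linear_combination e6
    refine ⟨-e, ?_⟩
    simp only [verticalConic, quad, ha, hb, hc, hd, hf]
    simp [hz12]
    ring
  · obtain ⟨e1, e2, e3⟩ := k0 (by decide)
    obtain ⟨e4, e5, e6⟩ := k1 (by decide)
    have hb : b = 0 := mul_left_cancel₀ ht (by linear_combination t * e6 - e3)
    have ha : a = 0 := mul_left_cancel₀ ht (by linear_combination t * e1 - e4)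
    have he : e = 0 := by linear_combination e6 - t ^ 2 * hb
    have hd : d = 0 := by linear_combination e1 - t ^ 2 * ha
    have hc : c = -f * t := by linear_combination e5
    refine ⟨-f, ?_⟩
    simp only [verticalConic, quad, ha, hb, hc, hd, he]
    simp [hz2, hz21]
    ring

/-- The conics of a Chilean family are determined by the six points through which they pass. -/
theorem IsChilean.exists_eq_C_mul {Q : Fin 4 × ZMod 3 → S} (hQ : IsChilean ω t Q)
    (hω : IsPrimitiveRoot ω 3) (h1 : t ^ 3 ≠ 1) (l : Fin 4 × ZMod 3) :
    ∃ c, c ≠ 0 ∧ Q l = C c * stdConic hω t l := by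
  suffices h : ∃ c, Q l = C c * stdConic hω t l by
    obtain ⟨c, hc⟩ := h
    refine ⟨c, ?_, hc⟩
    rintro rfl
    obtain ⟨v, hv⟩ := exists_mem_affLine l
    exact ((hQ l).2 v).1 (by simp [hc]) hv
  obtain ⟨j, d⟩ := l
  obtain ⟨hh, hv⟩ := hQ (j, d)
  fin_cases j
  · exact exists_eq_C_mul_verticalConic hω h1 hh fun v h0 =>
      (hv v).2 fun h2 => h0 ((mem_affLine_zero d v).1 h2)
  · exact exists_eq_C_mul_slopeConic hω h1 hh fun v h0 =>
      (hv v).2 fun h2 => h0 ((mem_affLine_one d v).1 h2)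
  · exact exists_eq_C_mul_slopeConic hω h1 hh fun v h0 =>
      (hv v).2 fun h2 => h0 ((mem_affLine_two d v).1 h2)
  · exact exists_eq_C_mul_slopeConic hω h1 hh fun v h0 =>
      (hv v).2 fun h2 => h0 ((mem_affLine_three d v).1 h2)

lemma stdConic_prime (hω : IsPrimitiveRoot ω 3) (h0 : t ≠ 0) (h1 : t ^ 3 ≠ 1) (h8 : t ^ 3 ≠ -8)
    (l : Fin 4 × ZMod 3) : Prime (stdConic hω t l) := by
  obtain ⟨j, d⟩ := l
  have hs (k s : ZMod 3) : Prime (slopeConic hω t k s) := by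
    have hk := cubeChar_pow_three hω k
    set τ := cubeChar hω k * t with hτ
    have hτ3 : τ ^ 3 = t ^ 3 := by rw [hτ, mul_pow, hk, one_mul]
    have e1 : τ - 1 ≠ 0 := fun h => h1 (by rw [← hτ3, sub_eq_zero.1 h, one_pow])
    have e2 : τ + 2 ≠ 0 := fun h => h8 (by rw [← hτ3, eq_neg_of_add_eq_zero_left h]; norm_num)
    refine quad_prime ?_
    rw [← hτ]
    have := mul_ne_zero (mul_ne_zero e2 (pow_ne_zero 2 e1)) (pow_ne_zero 2
      (mul_ne_zero (cubeChar_ne_zero hω (2 * k + 2 * s)) (cubeChar_ne_zero hω (2 * k + s))))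
    convert this using 1
    ring
  fin_cases j
  · have hz2 : (2 : ZMod 3) ≠ 0 := by decide
    have hz21 : (2 : ZMod 3) ≠ 1 := by decide
    have hz02 : (0 : ZMod 3) ≠ 2 := by decide
    have hz12 : (1 : ZMod 3) ≠ 2 := by decide
    refine quad_prime (a := if d = 0 then t else 0) ?_
    rcases zmodThree_cases d with rfl | rfl | rfl <;> simp [h0, hz2, hz21, hz02, hz12]
  · exact hs _ _
  · exact hs _ _
  · exact hs _ _

end Conics

/-! ### The lines of the dual Hesse arrangement -/

/-- The linear form `xᵢ - ωᵏ xᵢ₊₁`. -/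
noncomputable def hesseLine (ω : ℂ) (m : Fin 3 × Fin 3) : S :=
  X m.1 - C (ω ^ m.2.val) * X (m.1 + 1)

lemma hesseLine_isHomogeneous (ω : ℂ) (m : Fin 3 × Fin 3) : (hesseLine ω m).IsHomogeneous 1 :=
  (isHomogeneous_X ℂ _).sub (isHomogeneous_C_mul_X _ _)

lemma hesseLine_ne_zero (ω : ℂ) (m : Fin 3 × Fin 3) : hesseLine ω m ≠ 0 := by
  intro h
  have h1 := congrArg (eval (Pi.single m.1 1)) h
  simp [hesseLine] at h1

lemma hesseLine_prime (ω : ℂ) (m : Fin 3 × Fin 3) : Prime (hesseLine ω m) := by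
  have h0 := hesseLine_ne_zero ω m
  refine (irreducible_of_totalDegree_eq_one
    ((hesseLine_isHomogeneous ω m).totalDegree h0) fun x hx => ?_).prime
  obtain ⟨i, hi⟩ := ne_zero_iff.1 h0
  exact isUnit_iff_ne_zero.2 fun hx0 => hi (zero_dvd_iff.1 (hx0 ▸ hx i))

lemma eq_of_hesseLine_dvd {ω : ℂ} (hω : IsPrimitiveRoot ω 3) {m n : Fin 3 × Fin 3}
    (h : hesseLine ω m ∣ hesseLine ω n) : m = n := by
  have key (v : Fin 3 → ℂ) (hv : eval v (hesseLine ω m) = 0) : eval v (hesseLine ω n) = 0 := by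
    obtain ⟨r, hr⟩ := h
    rw [hr, map_mul, hv, zero_mul]
  obtain ⟨i, k⟩ := m
  obtain ⟨j, l⟩ := n
  have h1 := key (Pi.single (i + 2) 1)
  have hω0 : ω ≠ 0 := hω.ne_zero (by norm_num)
  have hij : i = j := by
    fin_cases i <;> fin_cases j <;> simp [hesseLine, hω0] at h1 ⊢
  subst hij
  have h2 := key (Pi.single i (ω ^ k.val) + Pi.single (i + 1) 1) (by simp [hesseLine])
  have h3 : ω ^ k.val = ω ^ l.val := by
    simpa [hesseLine, sub_eq_zero] using h2
  rw [Fin.ext (hω.pow_inj k.2 l.2 h3)]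

lemma prod_hesseLine {ω : ℂ} (hω : IsPrimitiveRoot ω 3) : ∏ m, hesseLine ω m = dualHesse := by
  have h3 : (C ω : S) ^ 3 = 1 := by rw [← C_pow, hω.pow_eq_one, C_1]
  have hs : 1 + (C ω : S) + C ω ^ 2 = 0 := by
    rw [← C_1, ← C_pow, ← C_add, ← C_add, one_add_add_sq_eq_zero hω, C_0]
  have key (x y : S) : (x - y) * (x - C ω * y) * (x - C ω ^ 2 * y) = x ^ 3 - y ^ 3 := by
    linear_combination (x * y ^ 2 * C ω - x ^ 2 * y) * hs - y ^ 3 * h3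
  simp only [Fintype.prod_prod_type, Fin.prod_univ_three, hesseLine, dualHesse, ← key]
  simp [show (2 : Fin 3) + 1 = 0 from rfl, show (1 : Fin 3) + 1 = 2 from rfl]

section Pencil

variable (t : ℂ)

/-! ### The pencil of sextics -/

/-- The power sum `x₀³ + x₁³ + x₂³`. -/
noncomputable def cubeSum : S := X 0 ^ 3 + X 1 ^ 3 + X 2 ^ 3

/-- The product `x₀x₁x₂`, divided by `t`; with this normalization the coefficients of the pencil
depend on `t` only through `t³`. -/
noncomputable def tripleProd : S := C t⁻¹ * (X 0 * X 1 * X 2)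

/-- The second elementary symmetric polynomial of the cubes of the coordinates. -/
noncomputable def cubeSymm : S :=
  X 0 ^ 3 * X 1 ^ 3 + X 1 ^ 3 * X 2 ^ 3 + X 2 ^ 3 * X 0 ^ 3

/-- The equation of the cubic of the Hesse pencil through the nine points. -/
noncomputable def pencilCubic : S := cubeSum - C (t ^ 3 + 2) * tripleProd t

/-- Up to a constant, the product of the three conics of the lines `a = const`: a sextic with double
points at the nine points. Together with the square of `pencilCubic` it spans the pencil of all
such sextics. -/
noncomputable def pencilSextic : S :=
  C (t ^ 3 - 1) * tripleProd t ^ 2 + cubeSum * tripleProd t - cubeSymm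

/-- Up to a constant, the product of the twelve conics, as a product of four members of the
pencil: `pencilSextic` and the three sextics that `prod_slopeConic` computes. -/
noncomputable def conicProd : S :=
  pencilSextic t * ((pencilCubic t ^ 2 - C (t ^ 3 - 4) * pencilSextic t) ^ 3 -
    C (27 * t ^ 6) * pencilSextic t ^ 3)

variable {t}

lemma mul_tripleProd (h0 : t ≠ 0) : C t * tripleProd t = X 0 * X 1 * X 2 := by
  rw [tripleProd, ← mul_assoc, ← C_mul, mul_inv_cancel₀ h0, C_1, one_mul]

lemma prod_verticalConic (h0 : t ≠ 0) :
    verticalConic t 0 * verticalConic t 1 * verticalConic t 2 = C (t ^ 2) * pencilSextic t := by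
  have hz2 : (2 : ZMod 3) ≠ 0 := by decide
  have hz21 : (2 : ZMod 3) ≠ 1 := by decide
  have hz02 : (0 : ZMod 3) ≠ 2 := by decide
  have hz12 : (1 : ZMod 3) ≠ 2 := by decide
  have hg := mul_tripleProd h0
  simp only [verticalConic, quad, pencilSextic, cubeSum, cubeSymm]
  generalize tripleProd t = G at *
  simp only [hz2, hz21, hz02, hz12, zero_ne_one, one_ne_zero, if_true, if_false, C_0, C_pow, C_sub,
    C_1, C_neg]
  linear_combination -((C t ^ 3 - 1) * (X 0 * X 1 * X 2 + C t * G) +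
    C t * (X 0 ^ 3 + X 1 ^ 3 + X 2 ^ 3)) * hg

/-- The group of cube roots of unity permutes the three conics of a parallel class by acting on the
three parts of their equations through its three characters. -/
lemma slopeConic_eq {ω : ℂ} (hω : IsPrimitiveRoot ω 3) {κ : ℂ} {k : ZMod 3}
    (hκ : cubeChar hω k = κ) (s : ZMod 3) :
    slopeConic hω t k s =
      (X 0 ^ 2 + C ((κ * t + 1) * κ) * (X 1 * X 2)) +
      C (cubeChar hω s) * (C κ * (X 1 ^ 2 + C ((κ * t + 1) * κ) * (X 0 * X 2))) +
      C (cubeChar hω s) ^ 2 * (C κ * (X 2 ^ 2 + C ((κ * t + 1) * κ) * (X 0 * X 1))) := by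
  set μ := cubeChar hω (2 * k + 2 * s) with hμ
  set ν := cubeChar hω (2 * k + s) with hν
  have h1 : μ ^ 2 = κ * cubeChar hω s := by
    rw [hμ, ← hκ, ← AddChar.map_nsmul_eq_pow, ← AddChar.map_add_eq_mul]
    exact congrArg _ ((by decide : ∀ k s : ZMod 3, 2 • (2 * k + 2 * s) = k + s) k s)
  have h2 : ν ^ 2 = κ * cubeChar hω s ^ 2 := by
    rw [hν, ← hκ, ← AddChar.map_nsmul_eq_pow, ← AddChar.map_nsmul_eq_pow,
      ← AddChar.map_add_eq_mul]
    exact congrArg _ ((by decide : ∀ k s : ZMod 3, 2 • (2 * k + s) = k + 2 • s) k s)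
  have h3 : μ * ν = κ := by
    rw [hμ, hν, ← hκ, ← AddChar.map_add_eq_mul]
    exact congrArg _ ((by decide : ∀ k s : ZMod 3, 2 * k + 2 * s + (2 * k + s) = k) k s)
  have h4 : ν = κ ^ 2 * cubeChar hω s := by
    rw [hν, ← hκ, ← AddChar.map_nsmul_eq_pow, ← AddChar.map_add_eq_mul]
    exact congrArg _ ((by decide : ∀ k s : ZMod 3, 2 * k + s = 2 • k + s) k s)
  have h5 : μ = κ ^ 2 * cubeChar hω s ^ 2 := by
    rw [hμ, ← hκ, ← AddChar.map_nsmul_eq_pow, ← AddChar.map_nsmul_eq_pow,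
      ← AddChar.map_add_eq_mul]
    exact congrArg _ ((by decide : ∀ k s : ZMod 3, 2 * k + 2 * s = 2 • k + 2 • s) k s)
  rw [slopeConic, orbitConic, ← hμ, ← hν, h1, h2, h3, h4, h5, hκ]
  simp only [quad, C_mul, C_add, C_pow, C_1]
  ring

/-- The three conics of a parallel class make up a sextic of the pencil. -/
lemma prod_slopeConic {ω : ℂ} (hω : IsPrimitiveRoot ω 3) (h0 : t ≠ 0) (k : ZMod 3) :
    slopeConic hω t k 0 * slopeConic hω t k 1 * slopeConic hω t k 2 =
      pencilCubic t ^ 2 - C (t ^ 3 - 4 + 3 * (cubeChar hω k * t) ^ 2) * pencilSextic t := by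
  have hs : 1 + (C ω : S) + C ω ^ 2 = 0 := by
    rw [← C_1, ← C_pow, ← C_add, ← C_add, one_add_add_sq_eq_zero hω, C_0]
  have hk : (C (cubeChar hω k) : S) ^ 3 = 1 := by rw [← C_pow, cubeChar_pow_three, C_1]
  have h1 : cubeChar hω 1 = ω := by rw [cubeChar_apply]; exact pow_one ω
  have h2 : cubeChar hω 2 = ω ^ 2 := by rw [cubeChar_apply]; rfl
  have hg := mul_tripleProd h0
  -- Since `1 + ω + ω² = 0`, the circulant product is `u³ + v³ + w³ - 3uvw`. This is invariant under
  -- the reflections in the nine lines, hence a polynomial in `cubeSum`, `tripleProd`, `cubeSymm`.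
  have key (u v w : S) : (u + 1 * v + 1 ^ 2 * w) * (u + C ω * v + C ω ^ 2 * w) *
      (u + C ω ^ 2 * v + (C ω ^ 2) ^ 2 * w) = u ^ 3 + v ^ 3 + w ^ 3 - 3 * (u * v * w) := by
    linear_combination ((C ω - 1) * (v ^ 2 + w ^ 2 * (C ω ^ 3 + 1) + C ω * u * w) +
      (u * v + u * w) + (C ω ^ 2 - C ω + 1) * v * w + (C ω - 1) * C ω ^ 2 * v * w) *
        (u + v + w) * hs
  rw [slopeConic_eq hω rfl 0, slopeConic_eq hω rfl 1, slopeConic_eq hω rfl 2, h1, h2,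
    AddChar.map_zero_eq_one, C_1, C_pow, key]
  simp only [pencilCubic, pencilSextic, cubeSum, cubeSymm, C_mul, C_add, C_pow, C_sub, C_1,
    map_ofNat]
  generalize tripleProd t = G at *
  generalize (C (cubeChar hω k) : S) = κ at *
  generalize (C t : S) = t at *
  generalize (X 0 : S) = x at *
  generalize (X 1 : S) = y at *
  generalize (X 2 : S) = z at *
  linear_combination
    ((y ^ 2 + (κ * t + 1) * κ * (x * z)) ^ 3 + (z ^ 2 + (κ * t + 1) * κ * (x * y)) ^ 3 +
      ((κ * t + 1) ^ 3 - 3 * (κ * t + 1) + t ^ 3) *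
        (x ^ 3 * y ^ 3 + y ^ 3 * z ^ 3 + z ^ 3 * x ^ 3) -
      (3 * κ * (κ * t + 1) ^ 2 * t + 3 * t ^ 3) * (x ^ 3 + y ^ 3 + z ^ 3) * G +
      (9 * t ^ 3 - 3 * κ ^ 2 * t ^ 5 - 3 * κ ^ 2 * (κ * t + 1) ^ 3 * t ^ 2) * G ^ 2) * hk -
    ((3 * ((κ * t + 1) * κ) - 3 * κ ^ 2 * ((κ * t + 1) * κ) ^ 2) * (x ^ 3 + y ^ 3 + z ^ 3) +
      (9 * ((κ * t + 1) * κ) ^ 2 - 3 * κ ^ 2 - 3 * κ ^ 2 * ((κ * t + 1) * κ) ^ 3) *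
        (x * y * z + t * G)) * hg

lemma prod_stdConic {ω : ℂ} (hω : IsPrimitiveRoot ω 3) (h0 : t ≠ 0) :
    ∏ l, stdConic hω t l = C (t ^ 2) * conicProd t := by
  have hs : 1 + (C ω : S) + C ω ^ 2 = 0 := by
    rw [← C_1, ← C_pow, ← C_add, ← C_add, one_add_add_sq_eq_zero hω, C_0]
  have h1 : cubeChar hω 1 = ω := by rw [cubeChar_apply]; exact pow_one ω
  have h2 : cubeChar hω 2 = ω ^ 2 := by rw [cubeChar_apply]; rfl
  have hprod (F : ZMod 3 → S) : ∏ d, F d = F 0 * F 1 * F 2 := Fin.prod_univ_three F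
  have h4 : (2 : ZMod 3) * 2 = 1 := by decide
  have e0 := prod_verticalConic h0
  have e1 := prod_slopeConic hω h0 0
  have e2 := prod_slopeConic hω h0 1
  have e3 := prod_slopeConic hω h0 2
  -- The offset `d` in direction `(1, 2)` corresponds to the shift `2 d`, which swaps two factors.
  have e3' : slopeConic hω t 2 0 * slopeConic hω t 2 2 * slopeConic hω t 2 1 = _ :=
    (by ring : _ = slopeConic hω t 2 0 * slopeConic hω t 2 1 * slopeConic hω t 2 2).trans e3
  simp only [Fintype.prod_prod_type, Fin.prod_univ_four, hprod, stdConic, Matrix.cons_val,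
    mul_zero, mul_one, h4, e0, e1, e2, e3', AddChar.map_zero_eq_one, h1, h2, conicProd]
  simp only [C_mul, C_add, C_pow, C_sub, C_1, map_ofNat]
  -- The product over `r ^ 3 = 1` of the factors `y - 3 (r t)² q` is `y³ - 27 t⁶ q³`.
  have key (y z : S) : (y - z) * (y - C ω ^ 2 * z) * (y - C ω ^ 4 * z) = y ^ 3 - z ^ 3 := by
    linear_combination (-(y ^ 2 * z) * (C ω ^ 2 - C ω + 1) +
      y * z ^ 2 * C ω ^ 2 * (C ω ^ 2 - C ω + 1) -
      z ^ 3 * (C ω - 1) * (C ω ^ 3 + 1)) * hs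
  have := key (pencilCubic t ^ 2 - (C t ^ 3 - 4) * pencilSextic t)
    (3 * C t ^ 2 * pencilSextic t)
  linear_combination C t ^ 2 * pencilSextic t * this

end Pencil

section Derivations

variable (t : ℂ)

/-! ### Derivations tangent to the twelve conics and to the nine lines -/

/-- The derivation `∑ xᵢ⁴ ∂ᵢ`, tangent to the nine lines. -/
noncomputable def powDer : Derivation ℂ S S := mkDerivation ℂ fun i => X i ^ 4

/-- The derivation `t (x₁²x₂² ∂₀ + x₀²x₂² ∂₁ + x₀²x₁² ∂₂)`, tangent to the nine lines. -/
noncomputable def crossDer : Derivation ℂ S S :=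
  mkDerivation ℂ ![C t * (X 1 * X 2) ^ 2, C t * (X 0 * X 2) ^ 2, C t * (X 0 * X 1) ^ 2]

/-- The monomial `k cⁱ gʲ qˡ` in the cubic `c`, the normalized product `g` of the coordinates and
the sextic `q`. -/
noncomputable def pencilMonomial (k : ℂ) (i j l : ℕ) : S :=
  C k * pencilCubic t ^ i * tripleProd t ^ j * pencilSextic t ^ l

/-- The combination `β (powDer + crossDer t) + γ crossDer t`, that is,
`β (∑ xᵢ⁴ ∂ᵢ) + (β + γ) t (x₁²x₂² ∂₀ + x₀²x₂² ∂₁ + x₀²x₁² ∂₂)`. -/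
noncomputable def combDer (β γ : S) : Derivation ℂ S S :=
  β • (powDer + crossDer t) + γ • crossDer t

variable {t}

lemma cubeSum_isHomogeneous : cubeSum.IsHomogeneous 3 :=
  ((isHomogeneous_X_pow _ _).add (isHomogeneous_X_pow _ _)).add (isHomogeneous_X_pow _ _)

lemma tripleProd_isHomogeneous : (tripleProd t).IsHomogeneous 3 :=
  (((isHomogeneous_X ℂ _).mul (isHomogeneous_X ℂ _)).mul (isHomogeneous_X ℂ _)).C_mul _

lemma cubeSymm_isHomogeneous : cubeSymm.IsHomogeneous 6 :=
  have h (i j : Fin 3) : (X i ^ 3 * X j ^ 3 : S).IsHomogeneous 6 :=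
    (isHomogeneous_X_pow (R := ℂ) i 3).mul (isHomogeneous_X_pow j 3)
  ((h _ _).add (h _ _)).add (h _ _)

lemma pencilCubic_isHomogeneous : (pencilCubic t).IsHomogeneous 3 :=
  cubeSum_isHomogeneous.sub (tripleProd_isHomogeneous.C_mul _)

lemma pencilSextic_isHomogeneous : (pencilSextic t).IsHomogeneous 6 :=
  (((tripleProd_isHomogeneous.pow 2).C_mul _).add
    (cubeSum_isHomogeneous.mul tripleProd_isHomogeneous)).sub cubeSymm_isHomogeneous

lemma pencilMonomial_isHomogeneous (k : ℂ) {i j l n : ℕ} (h : 3 * i + 3 * j + 6 * l = n) :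
    (pencilMonomial t k i j l).IsHomogeneous n := by
  have := (((isHomogeneous_C (Fin 3) k).mul ((pencilCubic_isHomogeneous (t := t)).pow i)).mul
    ((tripleProd_isHomogeneous (t := t)).pow j)).mul ((pencilSextic_isHomogeneous (t := t)).pow l)
  rw [zero_add, h] at this
  exact this

lemma derivation_apply_C_mul (D : Derivation ℂ S S) (a : ℂ) (p : S) :
    D (C a * p) = C a * D p := by
  rw [← smul_eq_C_mul, Derivation.map_smul, smul_eq_C_mul]

lemma powDer_cubeSum : powDer cubeSum = 3 * (cubeSum ^ 2 - 2 * cubeSymm) := by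
  simp [powDer, cubeSum, cubeSymm, mkDerivation_X, Derivation.leibniz_pow]
  ring

lemma powDer_tripleProd : powDer (tripleProd t) = cubeSum * tripleProd t := by
  simp [powDer, cubeSum, tripleProd, mkDerivation_X, Derivation.leibniz]
  ring

lemma powDer_cubeSymm (h0 : t ≠ 0) : powDer cubeSymm =
    3 * (cubeSum * cubeSymm - 3 * C t ^ 3 * tripleProd t ^ 3) := by
  have h : C t ^ 3 * tripleProd t ^ 3 = (X 0 * X 1 * X 2) ^ 3 := by
    rw [← mul_tripleProd h0, mul_pow]
  rw [mul_assoc, h]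
  simp [powDer, cubeSum, cubeSymm, mkDerivation_X, Derivation.leibniz, Derivation.leibniz_pow]
  ring

lemma crossDer_cubeSum (h0 : t ≠ 0) :
    crossDer t cubeSum = 9 * C t ^ 3 * tripleProd t ^ 2 := by
  have h : C t ^ 3 * tripleProd t ^ 2 = C t * (X 0 * X 1 * X 2) ^ 2 := by
    rw [← mul_tripleProd h0]; ring
  rw [mul_assoc, h]
  simp [crossDer, cubeSum, mkDerivation_X, Derivation.leibniz_pow]
  ring

lemma crossDer_tripleProd (h0 : t ≠ 0) : crossDer t (tripleProd t) = cubeSymm := by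
  have h : (C t⁻¹ : S) * C t = 1 := by rw [← C_mul, inv_mul_cancel₀ h0, C_1]
  simp [crossDer, cubeSymm, tripleProd, mkDerivation_X, Derivation.leibniz]
  linear_combination (X 0 ^ 3 * X 1 ^ 3 + X 1 ^ 3 * X 2 ^ 3 + X 2 ^ 3 * X 0 ^ 3) * h

lemma crossDer_cubeSymm (h0 : t ≠ 0) : crossDer t cubeSymm =
    6 * C t ^ 3 * cubeSum * tripleProd t ^ 2 := by
  have h : 6 * C t ^ 3 * cubeSum * tripleProd t ^ 2 =
      6 * C t * cubeSum * (X 0 * X 1 * X 2) ^ 2 := by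
    rw [← mul_tripleProd h0]; ring
  rw [h]
  simp [crossDer, cubeSum, cubeSymm, mkDerivation_X, Derivation.leibniz, Derivation.leibniz_pow]
  ring

lemma combDer_pencilCubic (h0 : t ≠ 0) (β γ : S) : combDer t β γ (pencilCubic t) =
    β * (3 * pencilCubic t ^ 2 + (4 * C t ^ 3 + 2) * pencilCubic t * tripleProd t +
        (C t ^ 3 + 8) * pencilSextic t) +
      γ * ((C t ^ 3 + 2) * pencilSextic t - (C t ^ 3 + 2) * pencilCubic t * tripleProd t -
        2 * (C t ^ 3 - 1) ^ 2 * tripleProd t ^ 2) := by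
  simp only [combDer, pencilCubic, Derivation.add_apply, Derivation.smul_apply, Derivation.map_sub,
    derivation_apply_C_mul, powDer_cubeSum, powDer_tripleProd, crossDer_cubeSum h0,
    crossDer_tripleProd h0, smul_eq_mul]
  simp only [pencilSextic, C_add, C_sub, C_pow, C_1, map_ofNat]
  ring

lemma combDer_pencilSextic (h0 : t ≠ 0) (β γ : S) : combDer t β γ (pencilSextic t) =
    β * (2 * pencilCubic t ^ 2 * tripleProd t + 2 * pencilCubic t * pencilSextic t +
        12 * tripleProd t * pencilSextic t) +
      γ * (pencilCubic t ^ 2 * tripleProd t - (C t ^ 3 - 1) * pencilCubic t * tripleProd t ^ 2 -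
        pencilCubic t * pencilSextic t - 3 * C t ^ 3 * tripleProd t * pencilSextic t) := by
  simp only [combDer, pencilSextic, Derivation.add_apply, Derivation.smul_apply, Derivation.map_sub,
    Derivation.map_add, derivation_C, Derivation.leibniz, Derivation.leibniz_pow,
    powDer_cubeSum, powDer_tripleProd, powDer_cubeSymm h0, crossDer_cubeSum h0,
    crossDer_tripleProd h0, crossDer_cubeSymm h0, smul_eq_mul, nsmul_eq_mul]
  simp only [pencilCubic, C_add, C_sub, C_pow, C_1, map_ofNat]
  push_cast
  ring

lemma apply_conicProd (D : Derivation ℂ S S) : D (conicProd t) =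
    6 * pencilCubic t * pencilSextic t *
        (pencilCubic t ^ 2 - (C t ^ 3 - 4) * pencilSextic t) ^ 2 * D (pencilCubic t) +
      ((pencilCubic t ^ 2 - (C t ^ 3 - 4) * pencilSextic t) ^ 3 -
        3 * (C t ^ 3 - 4) * pencilSextic t *
          (pencilCubic t ^ 2 - (C t ^ 3 - 4) * pencilSextic t) ^ 2 -
        108 * C t ^ 6 * pencilSextic t ^ 3) * D (pencilSextic t) := by
  simp only [conicProd, Derivation.leibniz, Derivation.leibniz_pow, Derivation.map_sub,
    derivation_C, smul_eq_mul, nsmul_eq_mul]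
  simp only [C_sub, C_mul, C_pow, map_ofNat]
  push_cast
  ring

lemma combDer_dualHesse (β γ : S) :
    combDer t β γ dualHesse = 6 * cubeSum * β * dualHesse := by
  simp [combDer, powDer, crossDer, dualHesse, cubeSum, mkDerivation_X, Derivation.leibniz,
    Derivation.leibniz_pow]
  ring

/-! ### The two Jacobian syzygies -/

/-- If `θ = combDer t β γ` multiplies the product of the conics by `K`, then
`θ - (K + 6 β (x₀³ + x₁³ + x₂³)) / 33` times the Euler derivation is a syzygy. -/
noncomputable def syzygy (t : ℂ) (β γ K : S) : Derivation ℂ S S :=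
  combDer t β γ - (C (1 / 33) * (K + 6 * cubeSum * β)) • euler

lemma syzygy_apply {β γ K : S} (hK : combDer t β γ (conicProd t) = K * conicProd t)
    (hF : (C (t ^ 2) * conicProd t * dualHesse).IsHomogeneous 33) :
    syzygy t β γ K (C (t ^ 2) * conicProd t * dualHesse) = 0 := by
  have h33 : (C (1 / 33) : S) * 33 = 1 := by
    rw [show (33 : S) = C 33 from (map_ofNat C 33).symm, ← C_mul]
    norm_num
  rw [syzygy, Derivation.sub_apply, Derivation.smul_apply, euler_apply hF, mul_assoc,
    derivation_apply_C_mul, Derivation.leibniz, hK, combDer_dualHesse]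
  simp only [smul_eq_mul, nsmul_eq_mul]
  push_cast
  linear_combination -(K + 6 * cubeSum * β) * (C (t ^ 2) * (conicProd t * dualHesse)) * h33

lemma syzygy_isHomogeneous {β γ K : S} (hβ : β.IsHomogeneous 12) (hγ : γ.IsHomogeneous 12)
    (hK : K.IsHomogeneous 15) (j : Fin 3) : (syzygy t β γ K (X j)).IsHomogeneous 16 := by
  have h1 : (powDer (X j)).IsHomogeneous 4 := by
    rw [powDer, mkDerivation_X]
    exact isHomogeneous_X_pow _ _
  have h2 : (crossDer t (X j)).IsHomogeneous 4 := by
    have h (i k : Fin 3) : (C t * (X i * X k) ^ 2).IsHomogeneous 4 :=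
      (((isHomogeneous_X ℂ i).mul (isHomogeneous_X ℂ k)).pow 2).C_mul t
    rw [crossDer, mkDerivation_X]
    fin_cases j
    · exact h _ _
    · exact h _ _
    · exact h _ _
  have h3 : (euler (X j)).IsHomogeneous 1 := by
    rw [euler, mkDerivation_X]
    exact isHomogeneous_X _ _
  have h6 : (6 * cubeSum * β).IsHomogeneous 15 := by
    rw [show (6 : S) = C 6 from (map_ofNat C 6).symm]
    exact (cubeSum_isHomogeneous.C_mul 6).mul hβ
  simp only [syzygy, combDer, Derivation.sub_apply, Derivation.add_apply, Derivation.smul_apply,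
    smul_eq_mul]
  exact ((hβ.mul (h1.add h2)).add (hγ.mul h2)).sub (((hK.add h6).C_mul _).mul h3)

/-- The Euler derivation and the two derivations `powDer` and `crossDer t` have determinant
`t` times the product of the nine lines. -/
lemma det_syzygy (β₁ γ₁ K₁ β₂ γ₂ K₂ : S) :
    (coeffMatrix ![euler, syzygy t β₁ γ₁ K₁, syzygy t β₂ γ₂ K₂]).det =
      C t * (β₁ * γ₂ - β₂ * γ₁) * dualHesse := by
  simp only [coeffMatrix, Matrix.det_fin_three, Matrix.of_apply, Matrix.cons_val, syzygy, combDer,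
    euler, powDer, crossDer, Derivation.sub_apply, Derivation.add_apply, Derivation.smul_apply,
    mkDerivation_X, smul_eq_mul, dualHesse]
  ring

variable (t)

/-- The coefficient `β` of the first solution `(β, γ, K)` = `(betaOne t, gammaOne t, multOne t)` of
`combDer t β γ P = K P`, where `P = conicProd t`. Comparing coefficients of monomials in `c`, `g`,
`q` turns this into a linear system; its solutions with `β`, `γ` of degree 12 form a plane, and the
two basis vectors chosen here have coefficients that are polynomials in `t³`. -/
noncomputable def betaOne : S :=
  pencilMonomial t (-1) 3 1 0 + pencilMonomial t (t ^ 3 - 1) 2 2 0 + pencilMonomial t 1 2 0 1 +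
    pencilMonomial t (t ^ 3 - 4) 1 1 1 + pencilMonomial t (-4 * (t ^ 3 - 1) ^ 2) 0 2 1 +
    pencilMonomial t (2 * t ^ 3 + 4) 0 0 2

/-- The coefficient `γ` of the first solution; see `betaOne`. -/
noncomputable def gammaOne : S :=
  pencilMonomial t 2 3 1 0 + pencilMonomial t (-4) 2 0 1 +
    pencilMonomial t (-8 * (t ^ 3 - 1)) 1 1 1 + pencilMonomial t (-(2 * t ^ 3 + 16)) 0 0 2

/-- The multiplier `K` of the first solution; see `betaOne`. -/
noncomputable def multOne : S :=
  pencilMonomial t (-24) 4 1 0 + pencilMonomial t (-24 * (t ^ 3 + 3)) 3 2 0 +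
    pencilMonomial t 24 3 0 1 + pencilMonomial t (48 * (t ^ 3 - 1)) 2 3 0 +
    pencilMonomial t (48 * (2 * t ^ 3 - 1)) 2 1 1 +
    pencilMonomial t (72 * (t ^ 6 + t ^ 3 - 4)) 1 2 1 +
    pencilMonomial t (24 * (t ^ 3 + 4)) 1 0 2 +
    pencilMonomial t (-192 * (t ^ 3 - 1) ^ 2) 0 3 1 +
    pencilMonomial t (24 * (t ^ 6 + 12 * t ^ 3 + 8)) 0 1 2

/-- The coefficient `β` of the second solution `(β, γ, K)` = `(betaTwo t, gammaTwo t, multTwo t)` of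
`combDer t β γ P = K P`, where `P = conicProd t`. -/
noncomputable def betaTwo : S :=
  pencilMonomial t (-1) 4 0 0 + pencilMonomial t (t ^ 3 - 1) 3 1 0 +
    pencilMonomial t (3 * t ^ 3 - 6) 2 0 1 + pencilMonomial t (-4 * (t ^ 3 - 1) ^ 2) 1 1 1 +
    pencilMonomial t ((t ^ 3 - 1) * (t ^ 3 + 8)) 0 0 2

/-- The coefficient `γ` of the second solution; see `betaTwo`. -/
noncomputable def gammaTwo : S :=
  pencilMonomial t 2 4 0 0 + pencilMonomial t (-8 * (t ^ 3 - 1)) 2 0 1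

/-- The multiplier `K` of the second solution; see `betaTwo`. -/
noncomputable def multTwo : S :=
  pencilMonomial t (-22) 5 0 0 + pencilMonomial t (-24 * (t ^ 3 + 3)) 4 1 0 +
    pencilMonomial t (48 * (t ^ 3 - 1)) 3 2 0 + pencilMonomial t (4 * (17 * t ^ 3 - 32)) 3 0 1 +
    pencilMonomial t (24 * (3 * t ^ 6 + 7 * t ^ 3 - 16)) 2 1 1 +
    pencilMonomial t (-192 * (t ^ 3 - 1) ^ 2) 1 2 1 +
    pencilMonomial t (2 * (t ^ 6 + 52 * t ^ 3 - 80)) 1 0 2 +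
    pencilMonomial t (48 * (t ^ 6 + 7 * t ^ 3 - 8)) 0 1 2

variable {t}

lemma combDer_conicProd_one (h0 : t ≠ 0) :
    combDer t (betaOne t) (gammaOne t) (conicProd t) = multOne t * conicProd t := by
  rw [apply_conicProd, combDer_pencilCubic h0, combDer_pencilSextic h0]
  simp only [betaOne, gammaOne, multOne, conicProd, pencilMonomial, C_mul, C_add, C_sub, C_neg,
    C_pow, C_1, map_ofNat]
  ring

lemma combDer_conicProd_two (h0 : t ≠ 0) :
    combDer t (betaTwo t) (gammaTwo t) (conicProd t) = multTwo t * conicProd t := by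
  rw [apply_conicProd, combDer_pencilCubic h0, combDer_pencilSextic h0]
  simp only [betaTwo, gammaTwo, multTwo, conicProd, pencilMonomial, C_mul, C_add, C_sub, C_neg,
    C_pow, C_1, map_ofNat]
  ring

/-- The two solutions are independent, with determinant the product of the conics. Together with
`det_syzygy` this is the determinant identity that Saito's criterion asks for. -/
lemma betaOne_mul_gammaTwo_sub :
    betaOne t * gammaTwo t - betaTwo t * gammaOne t = -2 * conicProd t := by
  simp only [betaOne, gammaOne, betaTwo, gammaTwo, conicProd, pencilMonomial, C_mul, C_add, C_sub,
    C_neg, C_pow, C_1, map_ofNat]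
  ring

lemma betaOne_isHomogeneous : (betaOne t).IsHomogeneous 12 := by
  unfold betaOne
  repeat' first
    | exact pencilMonomial_isHomogeneous _ (by norm_num)
    | refine IsHomogeneous.add ?_ ?_

lemma gammaOne_isHomogeneous : (gammaOne t).IsHomogeneous 12 := by
  unfold gammaOne
  repeat' first
    | exact pencilMonomial_isHomogeneous _ (by norm_num)
    | refine IsHomogeneous.add ?_ ?_

lemma multOne_isHomogeneous : (multOne t).IsHomogeneous 15 := by
  unfold multOne
  repeat' first
    | exact pencilMonomial_isHomogeneous _ (by norm_num)
    | refine IsHomogeneous.add ?_ ?_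

lemma betaTwo_isHomogeneous : (betaTwo t).IsHomogeneous 12 := by
  unfold betaTwo
  repeat' first
    | exact pencilMonomial_isHomogeneous _ (by norm_num)
    | refine IsHomogeneous.add ?_ ?_

lemma gammaTwo_isHomogeneous : (gammaTwo t).IsHomogeneous 12 := by
  unfold gammaTwo
  repeat' first
    | exact pencilMonomial_isHomogeneous _ (by norm_num)
    | refine IsHomogeneous.add ?_ ?_

lemma multTwo_isHomogeneous : (multTwo t).IsHomogeneous 15 := by
  unfold multTwo
  repeat' first
    | exact pencilMonomial_isHomogeneous _ (by norm_num)
    | refine IsHomogeneous.add ?_ ?_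

end Derivations

/-! ### Freeness of the extended arrangement -/

theorem extendedChilean_stdConic_free {ω t : ℂ} (hω : IsPrimitiveRoot ω 3) (h0 : t ≠ 0)
    (h1 : t ^ 3 ≠ 1) (h8 : t ^ 3 ≠ -8) :
    IsFreeCurve (extendedChilean (stdConic hω t)) ∧
      HasExponents (extendedChilean (stdConic hω t)) 16 16 := by
  set p : (Fin 4 × ZMod 3) ⊕ (Fin 3 × Fin 3) → S := Sum.elim (stdConic hω t) (hesseLine ω) with hp
  set d : (Fin 4 × ZMod 3) ⊕ (Fin 3 × Fin 3) → ℕ := Sum.elim (fun _ => 2) (fun _ => 1) with hd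
  have hCh := stdConic_isChilean hω h1
  have hhom : ∀ i, (p i).IsHomogeneous (d i) := by
    rintro (l | m)
    · exact (hCh l).1
    · exact hesseLine_isHomogeneous ω m
  have hprime : ∀ i, Prime (p i) := by
    rintro (l | m)
    · exact stdConic_prime hω h0 h1 h8 l
    · exact hesseLine_prime ω m
  have hdeg : ∀ i j, p i ∣ p j → d i = d j := by
    intro i j hij
    -- Primes that divide one another are associated, so they have the same degree.
    have hji := ((hprime i).dvd_prime_iff_associated (hprime j)).1 hij
    have e1 := totalDegree_le_of_dvd_of_isDomain hij (hprime j).ne_zero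
    have e2 := totalDegree_le_of_dvd_of_isDomain hji.symm.dvd (hprime i).ne_zero
    rw [(hhom i).totalDegree (hprime i).ne_zero, (hhom j).totalDegree (hprime j).ne_zero] at e1 e2
    exact le_antisymm e1 e2
  have hne : ∀ i j, i ≠ j → ¬ p i ∣ p j := by
    intro i j hij hdvd
    have hdij := hdeg i j hdvd
    rcases i with l | m <;> rcases j with l' | m'
    · refine hij (congrArg Sum.inl (eq_of_affLine_subset fun v hv => ?_).symm)
      by_contra hv'
      obtain ⟨r, hr⟩ : stdConic hω t l ∣ stdConic hω t l' := hdvd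
      refine ((hCh l').2 v).1 ?_ hv
      rw [hr, map_mul, ((hCh l).2 v).2 hv', zero_mul]
    · simp [hd] at hdij
    · simp [hd] at hdij
    · exact hij (congrArg Sum.inr (eq_of_hesseLine_dvd hω hdvd))
  have hprod : ∏ i, p i = C (t ^ 2) * conicProd t * dualHesse := by
    rw [hp, Fintype.prod_sum_type]
    simp only [Sum.elim_inl, Sum.elim_inr]
    rw [prod_stdConic hω h0, prod_hesseLine hω]
  have hext : extendedChilean (stdConic hω t) = ∏ i, p i := by
    rw [hprod, extendedChilean, prod_stdConic hω h0]
  have hF : (∏ i, p i).IsHomogeneous 33 := by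
    have := IsHomogeneous.prod Finset.univ p d fun i _ => hhom i
    simpa [hd, Fintype.sum_sum_type] using this
  have hF' := hF
  rw [hprod] at hF'
  rw [hext]
  refine isFreeCurve_and_hasExponents hprime hne hhom (by rintro (_ | _) <;> simp [hd])
    (by norm_num) hF
    (θ₁ := syzygy t (betaOne t) (gammaOne t) (multOne t))
    (θ₂ := syzygy t (betaTwo t) (gammaTwo t) (multTwo t))
    (hprod ▸ syzygy_apply (combDer_conicProd_one h0) hF')
    (hprod ▸ syzygy_apply (combDer_conicProd_two h0) hF')
    (syzygy_isHomogeneous betaOne_isHomogeneous gammaOne_isHomogeneous multOne_isHomogeneous)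
    (syzygy_isHomogeneous betaTwo_isHomogeneous gammaTwo_isHomogeneous multTwo_isHomogeneous)
    (c := -2 * t⁻¹) (by simpa using h0) ?_
  have ht : (C t⁻¹ : S) * C t = 1 := by rw [← C_mul, inv_mul_cancel₀ h0, C_1]
  rw [det_syzygy, betaOne_mul_gammaTwo_sub, hprod]
  simp only [C_mul, C_neg, C_pow, map_ofNat]
  linear_combination 2 * C t * conicProd t * dualHesse * ht

end ChileanArrangement

open ChileanArrangement in
theorem proposition2p2 (ω t : ℂ) (hω : IsPrimitiveRoot ω 3)
    (h0 : t ≠ 0) (h1 : t ^ 3 ≠ 1) (h8 : t ^ 3 ≠ -8) :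
    (∃ Q : Fin 4 × ZMod 3 → ChileanArrangement.S, ChileanArrangement.IsChilean ω t Q) ∧
    ∀ Q : Fin 4 × ZMod 3 → ChileanArrangement.S, ChileanArrangement.IsChilean ω t Q →
      ChileanArrangement.IsFreeCurve (ChileanArrangement.extendedChilean Q) ∧
      ChileanArrangement.HasExponents (ChileanArrangement.extendedChilean Q) 16 16 := by
  refine ⟨⟨stdConic hω t, stdConic_isChilean hω h1⟩, fun Q hQ => ?_⟩
  choose c hc hcQ using hQ.exists_eq_C_mul hω h1
  have h : extendedChilean Q =
      MvPolynomial.C (∏ l, c l) * extendedChilean (stdConic hω t) := by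
    simp only [extendedChilean, hcQ, Finset.prod_mul_distrib, map_prod, mul_assoc]
  rw [h]
  exact isFreeCurve_and_hasExponents_C_mul (Finset.prod_ne_zero_iff.2 fun l _ => hc l)
    (extendedChilean_stdConic_free hω h0 h1 h8)
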